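/- **Setting.** Let $A$ be an associative unital algebra over a commutative ring $\Bbbk$ and let $(\Omega^\bullet,\wedge,d)$ be an exterior algebra over $A$: an $\mathbb N$-graded associative $\Bbbk$-algebra with $\Omega^0=A$ and a $\Bbbk$-linear differential $d$ of degree $1$ with $d^2=0$ and the graded Leibniz rule, such that $\Omega^n$ is spanned by the products $a_0\,da_1\wedge\cdots\wedge da_n$. For a left $A$-module $M$ write $\Omega^kM=\Omega^k\otimes_AM$ and $J^1M=(A\otimes_{\Bbbk} A)/N\otimes_A M$, where $N=\{\sum a_i\otimes b_i:\sum a_ib_i=0,\ \sum a_i\,db_i=0\}$, with $j^1(m)=[1\otimes 1]\otimes m$, $\pi([a\otimes b]\otimes m)=abm$ and $\iota^1(a\,db\otimes m)=[a\otimes b-ab\otimes 1]\otimes m$. Let $E$ be a left $A$-module. * *Symmetric forms:* $S^0E=E$, $S^1E=\Omega^1E$, and for $k\ge 2$, $S^kE$ is the kernel of $\Omega^1S^{k-1}E\to\Omega^1\Omega^1S^{k-2}E\xrightarrow{\wedge}\Omega^2S^{k-2}E$. Let $\iota_\wedge^{k+1}:S^{k+1}E\hookrightarrow\Omega^1S^kE$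 be the inclusion ($\iota_\wedge^1=\mathrm{id}$). * *Holonomic jets:* $J^0E=E$, $J^1E$ is as above, and for $n\ge2$, $J^nE$ is the set of elements of $J^1J^{n-1}E$ whose image in $J^1J^1J^{n-2}E$ is killed by both maps $[a\otimes b]\otimes[c\otimes m]\mapsto a\,d(bc)\otimes m\in\Omega^1J^{n-2}E$ and $[a\otimes b]\otimes[c\otimes m]\mapsto da\wedge d(bc)\otimes m\in\Omega^2J^{n-2}E$. Let $\pi^{n,n-1}:J^nE\to J^{n-1}E$ be induced by $\pi$, and let $j^n:E\to J^nE$ and $\iota^n:S^nE\to J^nE$ be the maps induced recursively by $j^1$ and $\iota^1$, with $j^0=\iota^0=\mathrm{id}_E$. * The *elemental jets* are the $A$-submodule $\check J^nE=A\,j^n(E)\subseteq J^nE$. The *$n$-jet sequence at $E$ is right exact* if $S^nE\xrightarrow{\iota^n}J^nE\xrightarrow{\pi^{n,n-1}}J^{n-1}E\to0$ is exact (with $J^{-1}E=0$). * For a left $A$-module $F$, $\mathrm{Diff}^n(E,F)$ is the $\Bbbk$-module of maps $\widetilde\Delta\circ j^n$ with $\widetilde\Delta:J^nE\to F$ $A$-linear;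 $\mathrm{Diff}^{-1}=0$, $\mathrm{Diff}=\bigcup_n\mathrm{Diff}^n$, $\mathrm{Symb}^n(E,F)=\mathrm{Diff}^n(E,F)/\mathrm{Diff}^{n-1}(E,F)$ with quotient map $\varsigma^n$, and $\mathrm{Symb}^\bullet=\bigoplus_n\mathrm{Symb}^n$. If $J^nE=\check J^nE$, the *restriction symbol* $r^n:\mathrm{Symb}^n(E,F)\to{}_A\mathrm{Hom}(S^nE,F)$ is the well-defined map $\varsigma^n(\widetilde\Delta\circ j^n)\mapsto\widetilde\Delta\circ\iota^n$. * A *natural $n$-quantization* for $E$ is a natural transformation $q^n:\mathrm{Symb}^n(E,-)\to\mathrm{Diff}^n(E,-)$ of functors from left $A$-modules to $\Bbbk$-modules with $\varsigma^n\circ q^n=\mathrm{id}$. A *natural full quantization* for $E$ is the natural transformation $q=\sum_nq^n:\mathrm{Symb}^\bullet(E,-)\to\mathrm{Diff}(E,-)$ given by a collection of natural $n$-quantizations $q^n$, $n\in\mathbb N$. * A *connection* on a left $A$-module $M$ is a $\Bbbk$-linear map $\nabla:M\to\Omega^1M$ with $\nabla(am)=da\otimes m+a\nabla m$. **Corollary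 5.11 (Full quantization).** 1. Let $n\ge 0$. Suppose that $J^nE=\check J^nE$, that the $n$-jet sequence at $E$ is right exact, and that for all $0\le k<n$ we are given a connection $\nabla^{S^kE}$ on $S^kE$ and an $A$-linear retraction $s^{1,k}:\Omega^1S^kE\to S^{k+1}E$ of $\iota_\wedge^{k+1}$ (so $s^{1,0}=\mathrm{id}$). Then there is a natural $n$-quantization $q^n$ for $E$ such that, for every left $A$-module $F$ and every $\sigma\in\mathrm{Symb}^n(E,F)$, $$q^n(\sigma)=r^n(\sigma)\circ s^{1,n-1}\circ\nabla^{S^{n-1}E}\circ s^{1,n-2}\circ\nabla^{S^{n-2}E}\circ\cdots\circ s^{1,1}\circ\nabla^{S^1E}\circ\nabla^E$$ (for $n=0$ this reads $q^0(\sigma)=r^0(\sigma)$). 2. Suppose that for all $n\ge0$ we have $J^nE=\check J^nE$ and the $n$-jet sequence at $E$ is right exact, and that for all $n\ge 0$ we are given a connection $\nabla^{S^nE}$ on $S^nE$ and an $A$-linear retraction $s^{1,n}$ of $\iota_\wedge^{n+1}$. Then there is a natural full quantization $q=\sum_nq^n$ for $E$, whose components $q^n$ are given by the formula in part 1. -/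

import Mathlib

universe u v w

open scoped TensorProduct DirectSum

namespace NCJet

/-- An exterior algebra `(Ω, ∧, d)` over the associative unital `𝕜`-algebra `A`: an associative
`ℕ`-graded `𝕜`-algebra whose degree zero part is `A`, with a `𝕜`-linear differential `d` of
degree one that squares to zero and satisfies the graded Leibniz rule, such that every form is a
sum of products `a₀ da₁ ∧ ⋯ ∧ daₙ`. -/
structure ExteriorCalculus (𝕜 : Type w) (A Ω : Type u) [CommRing 𝕜] [Ring A] [Algebra 𝕜 A]
    [Ring Ω] [Algebra 𝕜 Ω] where
  /-- the module of forms of degree `n` -/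
  deg : ℕ → Submodule 𝕜 Ω
  graded : SetLike.GradedMonoid deg
  internal : DirectSum.IsInternal deg
  /-- the identification of `A` with the forms of degree zero -/
  incl : A →ₐ[𝕜] Ω
  incl_injective : Function.Injective incl
  range_incl : LinearMap.range incl.toLinearMap = deg 0
  /-- the differential -/
  d : Ω →ₗ[𝕜] Ω
  d_mem : ∀ {n : ℕ} {ω : Ω}, ω ∈ deg n → d ω ∈ deg (n + 1)
  d_d : ∀ ω : Ω, d (d ω) = 0
  leibniz : ∀ {n : ℕ} {ω : Ω}, ω ∈ deg n → ∀ η : Ω, d (ω * η) = d ω * η + (-1) ^ n * (ω * d η)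
  surjectivity : ∀ n : ℕ,
    deg (n + 1) ≤ Submodule.span 𝕜 {x | ∃ ω ∈ deg n, ∃ a : A, x = ω * d (incl a)}

section

variable {𝕜 : Type w} {A Ω : Type u} [CommRing 𝕜] [Ring A] [Algebra 𝕜 A] [Ring Ω] [Algebra 𝕜 Ω]
variable (C : ExteriorCalculus 𝕜 A Ω)

/-! ### The bimodules of forms -/

theorem ExteriorCalculus.incl_mem (a : A) : C.incl a ∈ C.deg 0 := by
  rw [← C.range_incl]; exact ⟨a, rfl⟩

theorem ExteriorCalculus.mul_mem {m n : ℕ} {x y : Ω} (hx : x ∈ C.deg m) (hy : y ∈ C.deg n) :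
    x * y ∈ C.deg (m + n) :=
  C.graded.mul_mem hx hy

theorem ExteriorCalculus.d_incl_mul (a b : A) :
    C.d (C.incl (a * b)) = C.d (C.incl a) * C.incl b + C.incl a * C.d (C.incl b) := by
  rw [map_mul, C.leibniz (C.incl_mem a)]; simp

/-- The module `Ωᵏ` of `k`-forms. -/
def Forms (k : ℕ) : Type u := ↥(C.deg k)

instance (k : ℕ) : AddCommGroup (Forms C k) := inferInstanceAs (AddCommGroup ↥(C.deg k))

instance (k : ℕ) : Module 𝕜 (Forms C k) := inferInstanceAs (Module 𝕜 ↥(C.deg k))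

variable {C} in
/-- The underlying element of the exterior algebra. -/
def Forms.val {k : ℕ} (ω : Forms C k) : Ω := Subtype.val (p := fun x => x ∈ C.deg k) ω

variable {C} in
/-- A homogeneous element, as a form. -/
def Forms.mk {k : ℕ} (x : Ω) (hx : x ∈ C.deg k) : Forms C k := (⟨x, hx⟩ : ↥(C.deg k))

variable {C} in
@[ext] theorem Forms.ext {k : ℕ} {ω η : Forms C k} (h : ω.val = η.val) : ω = η := Subtype.ext h

variable {C} in
theorem Forms.val_mem {k : ℕ} (ω : Forms C k) : ω.val ∈ C.deg k :=
  Subtype.property (p := fun x => x ∈ C.deg k) ω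

@[simp] theorem Forms.val_mk {k : ℕ} (x : Ω) (hx : x ∈ C.deg k) :
    (Forms.mk x hx : Forms C k).val = x := rfl

@[simp] theorem Forms.val_add {k : ℕ} (ω η : Forms C k) : (ω + η).val = ω.val + η.val := rfl

@[simp] theorem Forms.val_zero {k : ℕ} : (0 : Forms C k).val = 0 := rfl

@[simp] theorem Forms.val_smul {k : ℕ} (c : 𝕜) (ω : Forms C k) : (c • ω).val = c • ω.val := rfl

/-- The left action of `A` on forms is multiplication in the exterior algebra. -/
instance (k : ℕ) : SMul A (Forms C k) :=
  ⟨fun a ω => Forms.mk (C.incl a * ω.val)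
    (by simpa using C.mul_mem (C.incl_mem a) ω.val_mem)⟩

@[simp] theorem Forms.val_left_smul {k : ℕ} (a : A) (ω : Forms C k) :
    (a • ω).val = C.incl a * ω.val := rfl

instance (k : ℕ) : Module A (Forms C k) where
  one_smul ω := by ext; simp
  mul_smul a b ω := by ext; simp [mul_assoc]
  smul_zero a := by ext; simp
  smul_add a ω η := by ext; simp [mul_add]
  add_smul a b ω := by ext; simp [add_mul]
  zero_smul ω := by ext; simp

instance (k : ℕ) : IsScalarTower 𝕜 A (Forms C k) where
  smul_assoc c a ω := by ext; simp

/-- The right action `ω ↦ ω a` of `a : A` on forms. -/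
def rmul (k : ℕ) (a : A) : Forms C k →ₗ[A] Forms C k where
  toFun ω := Forms.mk (ω.val * C.incl a) (by simpa using C.mul_mem ω.val_mem (C.incl_mem a))
  map_add' ω η := by ext; simp [add_mul]
  map_smul' b ω := by ext; simp [mul_assoc]

/-- The differential `d : A → Ω¹`. -/
def dA : A →ₗ[𝕜] Forms C 1 where
  toFun a := Forms.mk (C.d (C.incl a)) (by simpa using C.d_mem (C.incl_mem a))
  map_add' a b := by ext; simp
  map_smul' c a := by ext; simp

/-- The wedge product of one-forms, with values in two-forms. -/
def wedge : Forms C 1 →ₗ[𝕜] Forms C 1 →ₗ[𝕜] Forms C 2 :=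
  LinearMap.mk₂ 𝕜 (fun ω η => Forms.mk (ω.val * η.val) (C.mul_mem ω.val_mem η.val_mem))
    (fun _ _ _ => by ext; simp [add_mul]) (fun _ _ _ => by ext; simp)
    (fun _ _ _ => by ext; simp [mul_add]) (fun _ _ _ => by ext; simp)

@[simp] theorem val_rmul {k : ℕ} (a : A) (ω : Forms C k) :
    (rmul C k a ω).val = ω.val * C.incl a := rfl

@[simp] theorem val_dA (a : A) : (dA C a).val = C.d (C.incl a) := rfl

@[simp] theorem val_wedge (ω η : Forms C 1) : (wedge C ω η).val = ω.val * η.val := rfl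

theorem dA_mul (a b : A) : dA C (a * b) = rmul C 1 b (dA C a) + a • dA C b := by
  ext; exact C.d_incl_mul a b

theorem dA_one : dA C 1 = 0 := by
  have h := dA_mul C 1 1
  have h1 : rmul C 1 1 (dA C 1) = dA C 1 := by ext; simp
  rw [mul_one, h1, one_smul] at h
  exact left_eq_add.mp h

/-- The map `a ⊗ b ↦ a db` from `A ⊗ A` to `Ω¹`. -/
def adb : A ⊗[𝕜] A →ₗ[𝕜] Forms C 1 :=
  TensorProduct.lift (LinearMap.mk₂ 𝕜 (fun a b => a • dA C b)
    (fun _ _ _ => by simp [add_smul]) (fun c a b => smul_assoc c a _)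
    (fun _ _ _ => by simp) (fun c a b => by rw [map_smul, smul_comm]))

@[simp] theorem adb_tmul (a b : A) : adb C (a ⊗ₜ b) = a • dA C b := rfl

theorem adb_surjective : Function.Surjective (adb C) := by
  have key : ∀ x ∈ Submodule.span 𝕜 {x | ∃ ω ∈ C.deg 0, ∃ a : A, x = ω * C.d (C.incl a)},
      ∃ t : A ⊗[𝕜] A, (adb C t).val = x := by
    intro x hx
    induction hx using Submodule.span_induction with
    | mem x h =>
      obtain ⟨ω, hω, a, rfl⟩ := h
      rw [← C.range_incl] at hω
      obtain ⟨b, rfl⟩ := hω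
      exact ⟨b ⊗ₜ a, rfl⟩
    | zero => exact ⟨0, by simp⟩
    | add x y _ _ hx hy =>
      obtain ⟨s, rfl⟩ := hx
      obtain ⟨t, rfl⟩ := hy
      exact ⟨s + t, by simp⟩
    | smul c x _ hx =>
      obtain ⟨s, rfl⟩ := hx
      exact ⟨c • s, by simp⟩
  intro ω
  obtain ⟨t, ht⟩ := key ω.val (C.surjectivity 0 ω.val_mem)
  exact ⟨t, Forms.ext ht⟩

/-! ### The functor `Ωᵏ ⊗_A -` -/

section Tensor

variable (k : ℕ) (M : Type u) [AddCommGroup M] [Module 𝕜 M] [Module A M] [IsScalarTower 𝕜 A M]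

/-- The relations `ω a ⊗ m = ω ⊗ a m`. -/
def balanced : Submodule A (Forms C k ⊗[𝕜] M) :=
  Submodule.span A {x | ∃ (ω : Forms C k) (a : A) (m : M),
    x = rmul C k a ω ⊗ₜ[𝕜] m - ω ⊗ₜ[𝕜] (a • m)}

/-- The left `A`-module `Ωᵏ ⊗_A M`. -/
def FormTensor : Type u := (Forms C k ⊗[𝕜] M) ⧸ balanced C k M

instance : AddCommGroup (FormTensor C k M) :=
  inferInstanceAs (AddCommGroup ((Forms C k ⊗[𝕜] M) ⧸ balanced C k M))

instance : Module A (FormTensor C k M) :=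
  inferInstanceAs (Module A ((Forms C k ⊗[𝕜] M) ⧸ balanced C k M))

instance : Module 𝕜 (FormTensor C k M) :=
  inferInstanceAs (Module 𝕜 ((Forms C k ⊗[𝕜] M) ⧸ balanced C k M))

instance : IsScalarTower 𝕜 A (FormTensor C k M) :=
  inferInstanceAs (IsScalarTower 𝕜 A ((Forms C k ⊗[𝕜] M) ⧸ balanced C k M))

end Tensor

section TensorMaps

variable {k : ℕ} {M : Type u} [AddCommGroup M] [Module 𝕜 M] [Module A M] [IsScalarTower 𝕜 A M]
variable {M' : Type u} [AddCommGroup M'] [Module 𝕜 M'] [Module A M'] [IsScalarTower 𝕜 A M']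
variable {P : Type*} [AddCommGroup P] [Module 𝕜 P] [Module A P] [IsScalarTower 𝕜 A P]

/-- The class `ω ⊗ m` in `Ωᵏ ⊗_A M`. -/
def ft (ω : Forms C k) (m : M) : FormTensor C k M := (balanced C k M).mkQ (ω ⊗ₜ[𝕜] m)

theorem ft_add (ω : Forms C k) (m n : M) : ft C ω (m + n) = ft C ω m + ft C ω n := by
  simp only [ft, TensorProduct.tmul_add, map_add]; rfl

theorem add_ft (ω η : Forms C k) (m : M) : ft C (ω + η) m = ft C ω m + ft C η m := by
  simp only [ft, TensorProduct.add_tmul, map_add]; rfl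

theorem ft_zero (ω : Forms C k) : ft C ω (0 : M) = 0 := by
  have h := ft_add C ω (0 : M) 0
  rw [add_zero] at h
  exact left_eq_add.mp h

theorem ft_smul (c : 𝕜) (ω : Forms C k) (m : M) : ft C ω (c • m) = c • ft C ω m := by
  unfold ft; rw [TensorProduct.tmul_smul]; rfl

theorem smul_ft (c : 𝕜) (ω : Forms C k) (m : M) : ft C (c • ω) m = c • ft C ω m := by
  unfold ft; rw [← TensorProduct.smul_tmul']; rfl

theorem left_smul_ft (a : A) (ω : Forms C k) (m : M) : ft C (a • ω) m = a • ft C ω m := by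
  unfold ft; rw [← TensorProduct.smul_tmul']; rfl

theorem rmul_ft (a : A) (ω : Forms C k) (m : M) : ft C (rmul C k a ω) m = ft C ω (a • m) := by
  exact (Submodule.Quotient.eq (balanced C k M)).mpr (Submodule.subset_span ⟨ω, a, m, rfl⟩)

/-- `ft` as a `𝕜`-bilinear map. -/
def ftHom : Forms C k →ₗ[𝕜] M →ₗ[𝕜] FormTensor C k M :=
  LinearMap.mk₂ 𝕜 (ft C) (fun _ _ _ => add_ft C _ _ _) (fun _ _ _ => smul_ft C _ _ _)
    (fun _ _ _ => ft_add C _ _ _) (fun _ _ _ => ft_smul C _ _ _)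

@[simp] theorem ftHom_apply (ω : Forms C k) (m : M) : ftHom C ω m = ft C ω m := rfl

theorem ft_induction {p : FormTensor C k M → Prop} (x : FormTensor C k M)
    (h : ∀ ω m, p (ft C ω m)) (h0 : p 0) (hadd : ∀ x y, p x → p y → p (x + y)) : p x := by
  obtain ⟨t, rfl⟩ := (balanced C k M).mkQ_surjective x
  induction t using TensorProduct.induction_on with
  | zero => rw [map_zero]; exact h0
  | tmul ω m => exact h ω m
  | add s t hs ht => rw [map_add]; exact hadd _ _ hs ht

/-- A balanced `𝕜`-bilinear map descends to `Ωᵏ ⊗_A M`. -/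
def ftLift (f : Forms C k →ₗ[𝕜] M →ₗ[𝕜] P)
    (hf : ∀ ω a m, f (rmul C k a ω) m = f ω (a • m)) : FormTensor C k M →ₗ[𝕜] P :=
  Submodule.liftQ ((balanced C k M).restrictScalars 𝕜) (TensorProduct.lift f) (by
    intro x hx
    suffices h : ∀ a : A, TensorProduct.lift f (a • x) = 0 by simpa using h 1
    have hx' : x ∈ balanced C k M := hx
    clear hx
    unfold balanced at hx'
    induction hx' using Submodule.span_induction with
    | mem x h =>
      obtain ⟨ω, b, m, rfl⟩ := h
      intro a
      rw [smul_sub, TensorProduct.smul_tmul', TensorProduct.smul_tmul', ← map_smul (rmul C k b),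
        map_sub, TensorProduct.lift.tmul, TensorProduct.lift.tmul, hf, sub_self]
    | zero => intro a; simp
    | add x y _ _ h1 h2 => intro a; rw [smul_add, map_add, h1, h2, add_zero]
    | smul b x _ h1 => intro a; rw [smul_smul, h1])

@[simp] theorem ftLift_ft (f : Forms C k →ₗ[𝕜] M →ₗ[𝕜] P)
    (hf : ∀ ω a m, f (rmul C k a ω) m = f ω (a • m)) (ω : Forms C k) (m : M) :
    ftLift C f hf (ft C ω m) = f ω m := rfl

/-- A balanced `𝕜`-bilinear map that is `A`-linear on the left descends to an `A`-linear map. -/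
def ftLiftA (f : Forms C k →ₗ[𝕜] M →ₗ[𝕜] P)
    (hf : ∀ ω a m, f (rmul C k a ω) m = f ω (a • m))
    (hl : ∀ (a : A) ω m, f (a • ω) m = a • f ω m) : FormTensor C k M →ₗ[A] P where
  toFun := ftLift C f hf
  map_add' := map_add _
  map_smul' a x := by
    induction x using ft_induction with
    | h ω m => rw [← left_smul_ft]; exact hl a ω m
    | h0 => simp
    | hadd x y hx hy =>
      simp only [RingHom.id_apply] at hx hy ⊢
      rw [smul_add, map_add, hx, hy, map_add, smul_add]

@[simp] theorem ftLiftA_ft (f : Forms C k →ₗ[𝕜] M →ₗ[𝕜] P)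
    (hf : ∀ ω a m, f (rmul C k a ω) m = f ω (a • m))
    (hl : ∀ (a : A) ω m, f (a • ω) m = a • f ω m) (ω : Forms C k) (m : M) :
    ftLiftA C f hf hl (ft C ω m) = f ω m := rfl

variable (k) in
/-- The functor `Ωᵏ ⊗_A -` on morphisms. -/
def ftMap (f : M →ₗ[A] M') : FormTensor C k M →ₗ[A] FormTensor C k M' :=
  ftLiftA C ((ftHom C).compl₂ (f.restrictScalars 𝕜))
    (fun ω a m => by simp [rmul_ft]) (fun a ω m => by simp [left_smul_ft])

@[simp] theorem ftMap_ft (f : M →ₗ[A] M') (ω : Forms C k) (m : M) :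
    ftMap C k f (ft C ω m) = ft C ω (f m) := rfl

/-- The wedge product with a fixed one-form, `η ⊗ m ↦ ω ∧ η ⊗ m`. -/
def wedgeFix (ω : Forms C 1) : FormTensor C 1 M →ₗ[𝕜] FormTensor C 2 M :=
  ftLift C ((ftHom C).comp (wedge C ω)) (fun η a m => by
    simp only [LinearMap.comp_apply, ftHom_apply]
    rw [← rmul_ft]; congr 1; ext; simp [mul_assoc])

theorem wedgeFix_ft (ω η : Forms C 1) (m : M) :
    wedgeFix C ω (ft C η m) = ft C (wedge C ω η) m := rfl

/-- The wedge product with a one-form, `η ⊗ m ↦ ω ∧ η ⊗ m`, as a bilinear map. -/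
def wedgeLeft : Forms C 1 →ₗ[𝕜] FormTensor C 1 M →ₗ[𝕜] FormTensor C 2 M :=
  LinearMap.mk₂ 𝕜 (fun ω x => wedgeFix C ω x)
    (fun ω η x => by
      induction x using ft_induction with
      | h θ m =>
        rw [wedgeFix_ft, wedgeFix_ft, wedgeFix_ft, map_add, LinearMap.add_apply, add_ft]
      | h0 => simp
      | hadd x y hx hy => simp only [map_add, hx, hy]; abel)
    (fun c ω x => by
      induction x using ft_induction with
      | h θ m => rw [wedgeFix_ft, wedgeFix_ft, map_smul, LinearMap.smul_apply, smul_ft]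
      | h0 => simp
      | hadd x y hx hy => simp only [map_add, hx, hy, smul_add])
    (fun ω x y => map_add _ _ _) (fun c ω x => map_smul _ _ _)

@[simp] theorem wedgeLeft_ft (ω η : Forms C 1) (m : M) :
    wedgeLeft C ω (ft C η m) = ft C (wedge C ω η) m := rfl

theorem wedgeLeft_rmul (a : A) (ω : Forms C 1) (x : FormTensor C 1 M) :
    wedgeLeft C (rmul C 1 a ω) x = wedgeLeft C ω (a • x) := by
  induction x using ft_induction with
  | h θ m =>
    rw [← left_smul_ft, wedgeLeft_ft, wedgeLeft_ft]; congr 1; ext; simp [mul_assoc]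
  | h0 => simp
  | hadd x y hx hy => rw [smul_add, map_add, map_add, hx, hy]

theorem wedgeLeft_smul (a : A) (ω : Forms C 1) (x : FormTensor C 1 M) :
    wedgeLeft C (a • ω) x = a • wedgeLeft C ω x := by
  induction x using ft_induction with
  | h θ m =>
    rw [wedgeLeft_ft, wedgeLeft_ft, ← left_smul_ft]; congr 1; ext; simp [mul_assoc]
  | h0 => simp
  | hadd x y hx hy => rw [map_add, map_add, smul_add, hx, hy]

variable (M) in
/-- The wedge product `Ω¹ ⊗_A Ω¹ ⊗_A M → Ω² ⊗_A M`. -/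
def wedge11 : FormTensor C 1 (FormTensor C 1 M) →ₗ[A] FormTensor C 2 M :=
  ftLiftA C (wedgeLeft C) (fun ω a m => wedgeLeft_rmul C a ω m)
    (fun a ω m => wedgeLeft_smul C a ω m)

@[simp] theorem wedge11_ft (ω : Forms C 1) (x : FormTensor C 1 M) :
    wedge11 C M (ft C ω x) = wedgeLeft C ω x := rfl

end TensorMaps

/-! ### The 1-jet functor -/

/-- `N`, the elements `∑ aᵢ ⊗ bᵢ` of `A ⊗ A` with `∑ aᵢ bᵢ = 0` and `∑ aᵢ dbᵢ = 0`. -/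
def jetRel : Submodule 𝕜 (A ⊗[𝕜] A) :=
  LinearMap.ker (LinearMap.mul' 𝕜 A) ⊓ LinearMap.ker (adb C)

section OneJet

variable (M : Type u) [AddCommGroup M] [Module 𝕜 M] [Module A M] [IsScalarTower 𝕜 A M]

variable (𝕜 A) in
variable {M} in
/-- The map `∑ aᵢ ⊗ bᵢ ↦ ∑ aᵢ ⊗ bᵢ m`. -/
def actOn (m : M) : A ⊗[𝕜] A →ₗ[𝕜] A ⊗[𝕜] M :=
  LinearMap.lTensor A ((LinearMap.toSpanSingleton A M m).restrictScalars 𝕜)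

variable (𝕜 A) in
variable {M} in
@[simp] theorem actOn_tmul (m : M) (a b : A) : actOn 𝕜 A m (a ⊗ₜ b) = a ⊗ₜ (b • m) := rfl

variable (𝕜 A) in
variable {M} in
theorem actOn_smul (m : M) (a : A) (t : A ⊗[𝕜] A) :
    actOn 𝕜 A m (a • t) = a • actOn 𝕜 A m t := by
  induction t using TensorProduct.induction_on with
  | zero => simp
  | tmul x y => simp [TensorProduct.smul_tmul']
  | add s t hs ht => simp only [smul_add, map_add, hs, ht]

/-- The submodule of `A ⊗ M` generated by the `∑ aᵢ ⊗ bᵢ m` with `∑ aᵢ ⊗ bᵢ` in `N`. -/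
def jetRelOn : Submodule A (A ⊗[𝕜] M) :=
  Submodule.span A {x | ∃ t ∈ jetRel C, ∃ m : M, x = actOn 𝕜 A m t}

/-- The 1-jet module `J¹M = (A ⊗ A)/N ⊗_A M`, presented as the quotient of `A ⊗ M` by the image
of `N ⊗ M`. -/
def OneJet : Type u := (A ⊗[𝕜] M) ⧸ jetRelOn C M

instance : AddCommGroup (OneJet C M) :=
  inferInstanceAs (AddCommGroup ((A ⊗[𝕜] M) ⧸ jetRelOn C M))

instance : Module A (OneJet C M) :=
  inferInstanceAs (Module A ((A ⊗[𝕜] M) ⧸ jetRelOn C M))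

instance : Module 𝕜 (OneJet C M) :=
  inferInstanceAs (Module 𝕜 ((A ⊗[𝕜] M) ⧸ jetRelOn C M))

instance : IsScalarTower 𝕜 A (OneJet C M) :=
  inferInstanceAs (IsScalarTower 𝕜 A ((A ⊗[𝕜] M) ⧸ jetRelOn C M))

end OneJet

section OneJetMaps

variable {M : Type u} [AddCommGroup M] [Module 𝕜 M] [Module A M] [IsScalarTower 𝕜 A M]
variable {M' : Type u} [AddCommGroup M'] [Module 𝕜 M'] [Module A M'] [IsScalarTower 𝕜 A M']
variable {P : Type*} [AddCommGroup P] [Module 𝕜 P] [Module A P] [IsScalarTower 𝕜 A P]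

/-- The quotient map `A ⊗ M → J¹M`. -/
def jetMk : A ⊗[𝕜] M →ₗ[A] OneJet C M := (jetRelOn C M).mkQ

/-- The 1-jet prolongation `j¹(m) = [1 ⊗ m]`. -/
def prol : M →ₗ[𝕜] OneJet C M :=
  ((jetMk C).restrictScalars 𝕜).comp (TensorProduct.mk 𝕜 A M 1)

theorem jetMk_tmul (a : A) (m : M) : jetMk C (a ⊗ₜ[𝕜] m) = a • prol C m := by
  unfold prol
  simp only [LinearMap.comp_apply, LinearMap.restrictScalars_apply, TensorProduct.mk_apply]
  rw [← map_smul, TensorProduct.smul_tmul', smul_eq_mul, mul_one]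

theorem jetMk_actOn (m : M) {t : A ⊗[𝕜] A} (ht : t ∈ jetRel C) :
    jetMk C (actOn 𝕜 A m t) = 0 := by
  exact (Submodule.Quotient.mk_eq_zero (jetRelOn C M)).mpr (Submodule.subset_span ⟨t, ht, m, rfl⟩)

theorem oneJet_induction {p : OneJet C M → Prop} (x : OneJet C M)
    (h : ∀ (a : A) m, p (a • prol C m)) (h0 : p 0) (hadd : ∀ x y, p x → p y → p (x + y)) :
    p x := by
  obtain ⟨t, rfl⟩ := (jetRelOn C M).mkQ_surjective x
  induction t using TensorProduct.induction_on with
  | zero => rw [map_zero]; exact h0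
  | tmul a m => have := h a m; rw [← jetMk_tmul] at this; exact this
  | add s t hs ht => rw [map_add]; exact hadd _ _ hs ht

/-- A `𝕜`-bilinear map on `A × M` that respects `N` descends to `J¹M`. -/
def jetLift (f : A →ₗ[𝕜] M →ₗ[𝕜] P)
    (hf : ∀ t ∈ jetRel C, ∀ m, TensorProduct.lift f (actOn 𝕜 A m t) = 0) :
    OneJet C M →ₗ[𝕜] P :=
  Submodule.liftQ ((jetRelOn C M).restrictScalars 𝕜) (TensorProduct.lift f) (by
    intro x hx
    suffices h : ∀ a : A, TensorProduct.lift f (a • x) = 0 by simpa using h 1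
    have hx' : x ∈ jetRelOn C M := hx
    clear hx
    unfold jetRelOn at hx'
    induction hx' using Submodule.span_induction with
    | mem x h =>
      obtain ⟨t, ht, m, rfl⟩ := h
      intro a
      rw [← actOn_smul]
      refine hf _ ?_ m
      have h1 : ∀ s : A ⊗[𝕜] A, LinearMap.mul' 𝕜 A (a • s) = a * LinearMap.mul' 𝕜 A s := by
        intro s
        induction s using TensorProduct.induction_on with
        | zero => simp
        | tmul x y => simp [TensorProduct.smul_tmul', mul_assoc]
        | add s t hs ht => simp only [smul_add, map_add, hs, ht, mul_add]
      have h2 : ∀ s : A ⊗[𝕜] A, adb C (a • s) = a • adb C s := by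
        intro s
        induction s using TensorProduct.induction_on with
        | zero => simp
        | tmul x y => simp [TensorProduct.smul_tmul', mul_smul]
        | add s t hs ht => simp only [smul_add, map_add, hs, ht]
      obtain ⟨h3, h4⟩ := ht
      refine ⟨?_, ?_⟩
      · change LinearMap.mul' 𝕜 A (a • t) = 0
        have h3' : LinearMap.mul' 𝕜 A t = 0 := h3
        rw [h1, h3', mul_zero]
      · change adb C (a • t) = 0
        have h4' : adb C t = 0 := h4
        rw [h2, h4', smul_zero]
    | zero => intro a; simp
    | add x y _ _ h1 h2 => intro a; rw [smul_add, map_add, h1, h2, add_zero]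
    | smul b x _ h1 => intro a; rw [smul_smul, h1])

@[simp] theorem jetLift_smul_prol (f : A →ₗ[𝕜] M →ₗ[𝕜] P)
    (hf : ∀ t ∈ jetRel C, ∀ m, TensorProduct.lift f (actOn 𝕜 A m t) = 0) (a : A) (m : M) :
    jetLift C f hf (a • prol C m) = f a m := by
  rw [← jetMk_tmul]; rfl

variable (A) in
/-- The bilinear map `(a, m) ↦ a f(m)`. -/
def extendMap (f : M →ₗ[𝕜] P) : A →ₗ[𝕜] M →ₗ[𝕜] P :=
  LinearMap.mk₂ 𝕜 (fun a m => a • f m) (fun _ _ _ => add_smul _ _ _)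
    (fun c a m => smul_assoc c a _) (fun _ _ _ => by simp)
    (fun c a m => by rw [map_smul, smul_comm])

@[simp] theorem extendMap_apply (f : M →ₗ[𝕜] P) (a : A) (m : M) :
    extendMap A f a m = a • f m := rfl

/-- The `A`-linear map `[a ⊗ m] ↦ a f(m)` on `J¹M` induced by a `𝕜`-linear `f` such that
`∑ aᵢ f(bᵢ m) = 0` whenever `∑ aᵢ ⊗ bᵢ` is in `N`. -/
def jetLiftA (f : M →ₗ[𝕜] P)
    (hf : ∀ t ∈ jetRel C, ∀ m, TensorProduct.lift (extendMap A f) (actOn 𝕜 A m t) = 0) :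
    OneJet C M →ₗ[A] P where
  toFun := jetLift C (extendMap A f) hf
  map_add' := map_add _
  map_smul' a x := by
    induction x using oneJet_induction with
    | h b m =>
      change jetLift C _ hf (a • b • prol C m) = a • jetLift C _ hf (b • prol C m)
      rw [smul_smul, jetLift_smul_prol, jetLift_smul_prol, extendMap_apply, extendMap_apply,
        mul_smul]
    | h0 => simp
    | hadd x y hx hy =>
      simp only [RingHom.id_apply] at hx hy ⊢
      rw [smul_add, map_add, hx, hy, map_add, smul_add]

@[simp] theorem jetLiftA_prol (f : M →ₗ[𝕜] P)
    (hf : ∀ t ∈ jetRel C, ∀ m, TensorProduct.lift (extendMap A f) (actOn 𝕜 A m t) = 0) (m : M) :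
    jetLiftA C f hf (prol C m) = f m := by
  have h := jetLift_smul_prol C (extendMap A f) hf 1 m
  rw [one_smul, extendMap_apply, one_smul] at h
  exact h

/-- A bilinear expression that is a combination of `∑ aᵢ bᵢ` and `∑ aᵢ dbᵢ` vanishes on `N`. -/
theorem vanish_on_jetRel (f : A →ₗ[𝕜] M →ₗ[𝕜] P) (m : M) (g : A →ₗ[𝕜] P)
    (h : Forms C 1 →ₗ[𝕜] P) (hfgh : ∀ a b : A, f a (b • m) = g (a * b) + h (a • dA C b)) :
    ∀ t ∈ jetRel C, TensorProduct.lift f (actOn 𝕜 A m t) = 0 := by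
  have key : (TensorProduct.lift f).comp (actOn 𝕜 A m) =
      g.comp (LinearMap.mul' 𝕜 A) + h.comp (adb C) := by
    apply TensorProduct.ext'
    intro a b
    simp [hfgh]
  intro t ht
  have h3 : LinearMap.mul' 𝕜 A t = 0 := ht.1
  have h4 : adb C t = 0 := ht.2
  have := LinearMap.congr_fun key t
  simpa [h3, h4] using this

/-- The functor `J¹` on morphisms, `[a ⊗ m] ↦ [a ⊗ f(m)]`. -/
def jetMap (f : M →ₗ[A] M') : OneJet C M →ₗ[A] OneJet C M' :=
  jetLiftA C ((prol C).comp (f.restrictScalars 𝕜)) (by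
    intro t ht m
    have key : (TensorProduct.lift (extendMap A ((prol C).comp (f.restrictScalars 𝕜)))).comp
        (actOn 𝕜 A m) = ((jetMk C).restrictScalars 𝕜).comp (actOn 𝕜 A (f m)) := by
      apply TensorProduct.ext'
      intro a b
      simp [jetMk_tmul]
    have h := LinearMap.congr_fun key t
    simp only [LinearMap.comp_apply, LinearMap.restrictScalars_apply] at h
    rw [h, jetMk_actOn C _ ht])

@[simp] theorem jetMap_prol (f : M →ₗ[A] M') (m : M) :
    jetMap C f (prol C m) = prol C (f m) := by
  simp [jetMap]

variable (M) in
/-- The projection `π : J¹M → M`, `[a ⊗ m] ↦ a m`. -/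
def proj : OneJet C M →ₗ[A] M :=
  jetLiftA C LinearMap.id (fun t ht m =>
    vanish_on_jetRel C _ m ((LinearMap.toSpanSingleton A M m).restrictScalars 𝕜) 0
      (fun a b => by simp [mul_smul]) t ht)

@[simp] theorem proj_prol (m : M) : proj C M (prol C m) = m := by
  simp [proj]

variable (M) in
/-- The `𝕜`-linear map `ρ : J¹M → Ω¹ ⊗_A M`, `[a ⊗ m] ↦ -da ⊗ m`. -/
def rho : OneJet C M →ₗ[𝕜] FormTensor C 1 M :=
  jetLift C (-((ftHom C).comp (dA C))) (fun t ht m =>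
    vanish_on_jetRel C _ m (-(((ftHom C).flip m).comp (dA C))) ((ftHom C).flip m)
      (fun a b => by simp [← rmul_ft, dA_mul]) t ht)

@[simp] theorem rho_smul_prol (a : A) (m : M) :
    rho C M (a • prol C m) = -ft C (dA C a) m := by
  simp [rho]

@[simp] theorem rho_prol (m : M) : rho C M (prol C m) = 0 := by
  have h := rho_smul_prol C 1 m
  rw [one_smul, dA_one, ← ftHom_apply] at h
  simpa using h

theorem rho_smul (a : A) (x : OneJet C M) :
    rho C M (a • x) = a • rho C M x - ft C (dA C a) (proj C M x) := by
  induction x using oneJet_induction with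
  | h b m =>
    rw [smul_smul, rho_smul_prol, rho_smul_prol, map_smul, proj_prol, dA_mul, add_ft, rmul_ft,
      left_smul_ft, smul_neg]
    abel
  | h0 => simp [ft_zero]
  | hadd x y hx hy =>
    rw [smul_add, map_add, hx, hy, map_add, map_add, ft_add, smul_add]; abel

/-- The expression `a ⊗ b ↦ [a ⊗ b m] - [a b ⊗ m]`. -/
def iotaAux (m : M) : A ⊗[𝕜] A →ₗ[𝕜] OneJet C M :=
  ((jetMk C).restrictScalars 𝕜).comp (actOn 𝕜 A m) -
    ((LinearMap.toSpanSingleton A (OneJet C M) (prol C m)).restrictScalars 𝕜).comp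
      (LinearMap.mul' 𝕜 A)

@[simp] theorem iotaAux_tmul (m : M) (a b : A) :
    iotaAux C m (a ⊗ₜ b) = a • prol C (b • m) - (a * b) • prol C m := by
  simp [iotaAux, jetMk_tmul]

theorem iotaAux_eq_zero (m : M) {t : A ⊗[𝕜] A} (ht : adb C t = 0) : iotaAux C m t = 0 := by
  have hmem : t - (LinearMap.mul' 𝕜 A t) ⊗ₜ[𝕜] (1 : A) ∈ jetRel C := by
    refine ⟨?_, ?_⟩
    · change LinearMap.mul' 𝕜 A _ = 0
      simp
    · change adb C _ = 0
      simp [ht, dA_one]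
  have h := jetMk_actOn C m hmem
  rw [map_sub, map_sub, actOn_tmul, jetMk_tmul, one_smul] at h
  exact h

theorem iotaAux_eq (m : M) {s t : A ⊗[𝕜] A} (h : adb C s = adb C t) :
    iotaAux C m s = iotaAux C m t := by
  rw [← sub_eq_zero, ← map_sub]
  exact iotaAux_eq_zero C m (by rw [map_sub, h, sub_self])

/-- The value of `ι` on `ω ⊗ m`, computed from any representation `ω = ∑ aᵢ dbᵢ`. -/
noncomputable def iotaFun (ω : Forms C 1) (m : M) : OneJet C M :=
  iotaAux C m (Function.surjInv (adb_surjective C) ω)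

theorem iotaFun_adb (t : A ⊗[𝕜] A) (m : M) : iotaFun C (adb C t) m = iotaAux C m t :=
  iotaAux_eq C m (Function.surjInv_eq (adb_surjective C) _)

theorem iotaAux_add (m n : M) (t : A ⊗[𝕜] A) :
    iotaAux C (m + n) t = iotaAux C m t + iotaAux C n t := by
  induction t using TensorProduct.induction_on with
  | zero => simp
  | tmul a b => simp; abel
  | add s t hs ht => simp only [map_add, hs, ht]; abel

theorem iotaAux_ksmul (c : 𝕜) (m : M) (t : A ⊗[𝕜] A) :
    iotaAux C (c • m) t = c • iotaAux C m t := by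
  induction t using TensorProduct.induction_on with
  | zero => simp
  | tmul a b =>
    simp only [iotaAux_tmul, map_smul, smul_sub]
    rw [smul_comm b c m, map_smul, smul_comm a c, smul_comm (a * b) c]
  | add s t hs ht => simp only [map_add, hs, ht, smul_add]

variable (M) in
/-- The inclusion `ι : Ω¹ ⊗_A M → J¹M`, `a db ⊗ m ↦ [a ⊗ b m] - [a b ⊗ m]`. -/
noncomputable def iota : FormTensor C 1 M →ₗ[A] OneJet C M :=
  ftLiftA C
    (LinearMap.mk₂ 𝕜 (iotaFun C)
      (fun ω η m => by
        obtain ⟨s, rfl⟩ := adb_surjective C ω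
        obtain ⟨t, rfl⟩ := adb_surjective C η
        rw [← map_add, iotaFun_adb, iotaFun_adb, iotaFun_adb, map_add])
      (fun c ω m => by
        obtain ⟨s, rfl⟩ := adb_surjective C ω
        rw [← map_smul, iotaFun_adb, iotaFun_adb, map_smul])
      (fun ω m n => iotaAux_add C m n _)
      (fun c ω m => iotaAux_ksmul C c m _))
    (fun ω a m => by
      obtain ⟨s, rfl⟩ := adb_surjective C ω
      change iotaFun C (rmul C 1 a (adb C s)) m = iotaFun C (adb C s) (a • m)
      induction s using TensorProduct.induction_on with
      | zero =>
        simp only [map_zero]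
        rw [← map_zero (adb C), iotaFun_adb, iotaFun_adb]; simp
      | tmul x y =>
        have h : rmul C 1 a (adb C (x ⊗ₜ y)) = adb C (x ⊗ₜ (y * a) - (x * y) ⊗ₜ a) := by
          simp [dA_mul, mul_smul]
        rw [h, iotaFun_adb, iotaFun_adb]
        simp [mul_smul, mul_assoc]
      | add s t hs ht =>
        obtain ⟨s', hs'⟩ := adb_surjective C (rmul C 1 a (adb C s))
        obtain ⟨t', ht'⟩ := adb_surjective C (rmul C 1 a (adb C t))
        rw [← hs', iotaFun_adb, iotaFun_adb] at hs
        rw [← ht', iotaFun_adb, iotaFun_adb] at ht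
        rw [map_add, map_add, ← hs', ← ht', ← map_add, ← map_add, iotaFun_adb, iotaFun_adb,
          map_add, map_add, hs, ht])
    (fun a ω m => by
      obtain ⟨s, rfl⟩ := adb_surjective C ω
      change iotaFun C (a • adb C s) m = a • iotaFun C (adb C s) m
      have h : a • adb C s = adb C (a • s) := by
        induction s using TensorProduct.induction_on with
        | zero => simp
        | tmul x y => simp [TensorProduct.smul_tmul', mul_smul]
        | add s t hs ht => simp only [smul_add, map_add, hs, ht]
      rw [h, iotaFun_adb, iotaFun_adb]
      clear h
      induction s using TensorProduct.induction_on with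
      | zero => simp
      | tmul x y => simp [TensorProduct.smul_tmul', mul_smul, smul_sub]
      | add s t hs ht => simp only [smul_add, map_add, hs, ht])

theorem iota_adb (a b : A) (m : M) :
    iota C M (ft C (a • dA C b) m) = a • prol C (b • m) - (a * b) • prol C m := by
  rw [← iotaAux_tmul, ← iotaFun_adb]; rfl

/-- `Ω¹ ⊗_A M` is spanned by the elements `a db ⊗ m`. -/
theorem ft_one_induction {p : FormTensor C 1 M → Prop} (x : FormTensor C 1 M)
    (h : ∀ (a b : A) m, p (ft C (a • dA C b) m)) (h0 : p 0)
    (hadd : ∀ x y, p x → p y → p (x + y)) : p x := by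
  induction x using ft_induction with
  | h ω m =>
    obtain ⟨t, rfl⟩ := adb_surjective C ω
    induction t using TensorProduct.induction_on with
    | zero => rw [map_zero, ← ftHom_apply, map_zero]; exact h0
    | tmul a b => exact h a b m
    | add s t hs ht => rw [map_add, add_ft]; exact hadd _ _ hs ht
  | h0 => exact h0
  | hadd x y hx hy => exact hadd x y hx hy

theorem iota_natural (f : M →ₗ[A] M') (x : FormTensor C 1 M) :
    jetMap C f (iota C M x) = iota C M' (ftMap C 1 f x) := by
  induction x using ft_one_induction with
  | h a b m => simp [iota_adb]
  | h0 => simp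
  | hadd x y hx hy => simp only [map_add, hx, hy]

@[simp] theorem proj_iota (x : FormTensor C 1 M) : proj C M (iota C M x) = 0 := by
  induction x using ft_one_induction with
  | h a b m => simp [iota_adb, mul_smul]
  | h0 => simp
  | hadd x y hx hy => simp only [map_add, hx, hy, add_zero]

@[simp] theorem rho_iota (x : FormTensor C 1 M) : rho C M (iota C M x) = x := by
  induction x using ft_one_induction with
  | h a b m =>
    rw [iota_adb, map_sub, rho_smul_prol, rho_smul_prol, dA_mul, add_ft, rmul_ft]; abel
  | h0 => simp
  | hadd x y hx hy => simp only [map_add, hx, hy]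

/-! ### The operator whose kernel cuts out holonomic jets -/

variable (M) in
/-- `[a ⊗ b] ⊗ [c ⊗ m] ↦ a d(b c) ⊗ m`, from `J¹J¹M` to `Ω¹ ⊗_A M`. -/
def DI : OneJet C (OneJet C M) →ₗ[A] FormTensor C 1 M :=
  jetLiftA C (-rho C M) (fun t ht x =>
    vanish_on_jetRel C _ x
      (-((LinearMap.toSpanSingleton A (FormTensor C 1 M) (rho C M x)).restrictScalars 𝕜))
      ((ftHom C).flip (proj C M x))
      (fun a b => by
        simp only [extendMap_apply, LinearMap.neg_apply, rho_smul, LinearMap.flip_apply,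
          ftHom_apply, left_smul_ft, LinearMap.restrictScalars_apply,
          LinearMap.toSpanSingleton_apply, mul_smul, smul_neg, smul_sub]
        abel) t ht)

@[simp] theorem DI_prol (x : OneJet C M) : DI C M (prol C x) = -rho C M x := by
  simp [DI]

theorem wedge_dA_dA (a b : A) :
    (wedge C (dA C a) (dA C b)).val = C.d (C.incl a * C.d (C.incl b)) := by
  rw [C.leibniz (C.incl_mem a), C.d_d]; simp

/-- The restriction of the differential to a map `Ω¹ → Ω²`. -/
def d1 : Forms C 1 →ₗ[𝕜] Forms C 2 where
  toFun ω := Forms.mk (C.d ω.val) (C.d_mem ω.val_mem)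
  map_add' ω η := by ext; simp
  map_smul' c ω := by ext; simp

theorem d1_smul_dA (a b : A) : d1 C (a • dA C b) = wedge C (dA C a) (dA C b) := by
  ext; rw [wedge_dA_dA]; rfl

variable (M) in
/-- `[a ⊗ b] ⊗ [c ⊗ m] ↦ da ∧ d(b c) ⊗ m`, from `J¹J¹M` to `Ω² ⊗_A M`. -/
def DII : OneJet C (OneJet C M) →ₗ[𝕜] FormTensor C 2 M :=
  jetLift C (((wedgeLeft C).comp (dA C)).compl₂ (-rho C M)) (fun t ht x =>
    vanish_on_jetRel C _ x
      (-(((wedgeLeft C).flip (rho C M x)).comp (dA C)))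
      (((ftHom C).flip (proj C M x)).comp (d1 C) + (wedgeLeft C).flip (rho C M x))
      (fun a b => by
        simp only [LinearMap.compl₂_apply, LinearMap.comp_apply, LinearMap.neg_apply, rho_smul,
          LinearMap.add_apply, LinearMap.flip_apply, ftHom_apply, d1_smul_dA, dA_mul, map_neg,
          map_sub, map_add, wedgeLeft_ft, wedgeLeft_rmul]
        abel) t ht)

@[simp] theorem DII_smul_prol (a : A) (x : OneJet C M) :
    DII C M (a • prol C x) = -wedgeLeft C (dA C a) (rho C M x) := by
  simp [DII]

theorem DI_formula (a b c : A) (m : M) :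
    DI C M (a • prol C (b • c • prol C m)) = ft C (a • dA C (b * c)) m := by
  rw [map_smul, DI_prol, smul_smul, rho_smul_prol, neg_neg, left_smul_ft]

theorem DII_formula (a b c : A) (m : M) :
    DII C M (a • prol C (b • c • prol C m)) = ft C (wedge C (dA C a) (dA C (b * c))) m := by
  rw [DII_smul_prol, smul_smul, rho_smul_prol, map_neg, neg_neg, wedgeLeft_ft]

theorem DII_smul (a : A) (x : OneJet C (OneJet C M)) :
    DII C M (a • x) = a • DII C M x + wedgeLeft C (dA C a) (DI C M x) := by
  induction x using oneJet_induction with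
  | h b y =>
    rw [smul_smul, DII_smul_prol, DII_smul_prol, map_smul, DI_prol, dA_mul, map_add,
      LinearMap.add_apply, wedgeLeft_rmul, wedgeLeft_smul, smul_neg, smul_neg, map_neg]
    abel
  | h0 => simp
  | hadd x y hx hy => rw [smul_add, map_add, hx, hy, map_add, map_add, map_add, smul_add]; abel

theorem DI_iota_iota (x : FormTensor C 1 (FormTensor C 1 M)) :
    DI C M (jetMap C (iota C M) (iota C _ x)) = 0 := by
  induction x using ft_one_induction with
  | h a b y =>
    rw [iota_adb, map_sub, LinearMap.map_smul (jetMap C _), LinearMap.map_smul (jetMap C _),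
      jetMap_prol, jetMap_prol, map_sub, LinearMap.map_smul (DI C M), LinearMap.map_smul (DI C M),
      DI_prol, DI_prol, rho_iota, rho_iota, smul_neg, smul_neg, mul_smul, sub_self]
  | h0 => simp
  | hadd x y hx hy => simp only [map_add, hx, hy, add_zero]

theorem DII_iota_iota (x : FormTensor C 1 (FormTensor C 1 M)) :
    DII C M (jetMap C (iota C M) (iota C _ x)) = wedge11 C M x := by
  induction x using ft_one_induction with
  | h a b y =>
    rw [iota_adb, map_sub, LinearMap.map_smul (jetMap C _),
      LinearMap.map_smul (jetMap C _), jetMap_prol, jetMap_prol, map_sub, DII_smul_prol,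
      DII_smul_prol, rho_iota, rho_iota, wedge11_ft, dA_mul, map_add, LinearMap.add_apply,
      wedgeLeft_rmul]
    abel
  | h0 => simp
  | hadd x y hx hy => simp only [map_add, hx, hy]

theorem wedge11_natural (f : M →ₗ[A] M') (x : FormTensor C 1 (FormTensor C 1 M)) :
    wedge11 C M' (ftMap C 1 (ftMap C 1 f) x) = ftMap C 2 f (wedge11 C M x) := by
  induction x using ft_induction with
  | h ω y =>
    rw [ftMap_ft, wedge11_ft, wedge11_ft]
    induction y using ft_induction with
    | h η m => simp
    | h0 => simp
    | hadd x y hx hy => simp only [map_add, hx, hy]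
  | h0 => simp
  | hadd x y hx hy => simp only [map_add, hx, hy]

end OneJetMaps

section Higher

variable {M : Type u} [AddCommGroup M] [Module 𝕜 M] [Module A M] [IsScalarTower 𝕜 A M]
variable {M' : Type u} [AddCommGroup M'] [Module 𝕜 M'] [Module A M'] [IsScalarTower 𝕜 A M']

/-- For `l : Jⁿ⁺¹ → J¹Jⁿ`, the holonomic part of `J¹Jⁿ⁺¹`: the kernel of
`J¹Jⁿ⁺¹ → J¹J¹Jⁿ → (Ω¹ × Ω²)Jⁿ`. -/
def holonomic (l : M' →ₗ[A] OneJet C M) : Submodule A (OneJet C M') where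
  carrier := {x | DI C M (jetMap C l x) = 0 ∧ DII C M (jetMap C l x) = 0}
  add_mem' := by
    rintro x y ⟨h1, h2⟩ ⟨h3, h4⟩
    exact ⟨by rw [map_add, map_add, h1, h3, add_zero], by rw [map_add, map_add, h2, h4, add_zero]⟩
  zero_mem' := ⟨by simp, by simp⟩
  smul_mem' := by
    rintro a x ⟨h1, h2⟩
    exact ⟨by rw [map_smul, map_smul, h1, smul_zero],
      by rw [map_smul, DII_smul, h1, h2]; simp⟩

/-- For `l : Sⁿ⁺¹ → Ω¹Sⁿ`, the symmetric part of `Ω¹Sⁿ⁺¹`: the kernel of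
`Ω¹Sⁿ⁺¹ → Ω¹Ω¹Sⁿ → Ω²Sⁿ`. -/
def symmetric (l : M' →ₗ[A] FormTensor C 1 M) : Submodule A (FormTensor C 1 M') :=
  LinearMap.ker ((wedge11 C M).comp (ftMap C 1 l))

end Higher

/-! ### Holonomic jets and symmetric forms of all orders -/

variable (𝕜 A) in
/-- A bundled left `A`-module (with its induced `𝕜`-module structure). -/
structure LMod where
  carrier : Type u
  [grp : AddCommGroup carrier]
  [modk : Module 𝕜 carrier]
  [modA : Module A carrier]
  [tower : IsScalarTower 𝕜 A carrier]

attribute [instance] LMod.grp LMod.modk LMod.modA LMod.tower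

variable (E : Type u) [AddCommGroup E] [Module 𝕜 E] [Module A E] [IsScalarTower 𝕜 A E]

/-- Two consecutive jet modules `JⁿE`, `Jⁿ⁺¹E` with the map `l : Jⁿ⁺¹E → J¹JⁿE` and the
prolongations of elements of `E`. -/
structure JetStage where
  lo : LMod.{u} 𝕜 A
  hi : LMod.{u} 𝕜 A
  l : hi.carrier →ₗ[A] OneJet C lo.carrier
  jlo : E →ₗ[𝕜] lo.carrier
  jhi : E →ₗ[𝕜] hi.carrier
  l_jhi : ∀ e, l (jhi e) = prol C (jlo e)

/-- The jet modules of orders `0` and `1`. -/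
def JetStage.zero : JetStage C E where
  lo := ⟨E⟩
  hi := ⟨OneJet C E⟩
  l := LinearMap.id
  jlo := LinearMap.id
  jhi := prol C
  l_jhi _ := rfl

variable {C E} in
/-- From the jet modules of orders `n`, `n + 1` to those of orders `n + 1`, `n + 2`. -/
def JetStage.succ (s : JetStage C E) : JetStage C E where
  lo := s.hi
  hi := ⟨↥(holonomic C s.l)⟩
  l := (holonomic C s.l).subtype
  jlo := s.jhi
  jhi := LinearMap.codRestrict ((holonomic C s.l).restrictScalars 𝕜) ((prol C).comp s.jhi)
    (fun e => by
      have h : jetMap C s.l (prol C (s.jhi e)) = prol C (prol C (s.jlo e)) := by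
        rw [jetMap_prol, s.l_jhi]
      refine ⟨?_, ?_⟩
      · rw [LinearMap.comp_apply, h, DI_prol, rho_prol, neg_zero]
      · have h2 := DII_smul_prol C 1 (prol C (s.jlo e))
        rw [LinearMap.comp_apply, h]
        simpa using h2)
  l_jhi _ := rfl

/-- The tower of holonomic jet modules. -/
def jetStage : ℕ → JetStage C E
  | 0 => JetStage.zero C E
  | n + 1 => (jetStage n).succ

/-- The holonomic jet module `JⁿE`: `J⁰E = E`, `J¹E`, and for `n ≥ 2` the kernel of
`J¹Jⁿ⁻¹E → J¹J¹Jⁿ⁻²E → (Ω¹ × Ω²)Jⁿ⁻²E`. -/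
abbrev Jet (n : ℕ) : Type u := (jetStage C E n).lo.carrier

/-- The natural map `l : Jⁿ⁺¹E → J¹JⁿE`. -/
def jetIncl (n : ℕ) : Jet C E (n + 1) →ₗ[A] OneJet C (Jet C E n) := (jetStage C E n).l

/-- The jet prolongation `jⁿ : E → JⁿE`. -/
def jetProl (n : ℕ) : E →ₗ[𝕜] Jet C E n := (jetStage C E n).jlo

/-- The jet projection `π : Jⁿ⁺¹E → JⁿE`. -/
def jetProj (n : ℕ) : Jet C E (n + 1) →ₗ[A] Jet C E n :=
  (proj C (Jet C E n)).comp (jetIncl C E n)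

/-- Two consecutive modules `SⁿE`, `Sⁿ⁺¹E` of symmetric forms with the map `Sⁿ⁺¹E → Ω¹SⁿE`. -/
structure SymStage where
  lo : LMod.{u} 𝕜 A
  hi : LMod.{u} 𝕜 A
  l : hi.carrier →ₗ[A] FormTensor C 1 lo.carrier

/-- Symmetric forms of orders `0` and `1`. -/
def SymStage.zero : SymStage C where
  lo := ⟨E⟩
  hi := ⟨FormTensor C 1 E⟩
  l := LinearMap.id

variable {C} in
/-- From symmetric forms of orders `n`, `n + 1` to those of orders `n + 1`, `n + 2`. -/
def SymStage.succ (s : SymStage C) : SymStage C where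
  lo := s.hi
  hi := ⟨↥(symmetric C s.l)⟩
  l := (symmetric C s.l).subtype

/-- The tower of symmetric forms with values in `E`. -/
def symStage : ℕ → SymStage C
  | 0 => SymStage.zero C E
  | n + 1 => (symStage n).succ

/-- The module `SⁿE` of symmetric forms: `S⁰E = E`, `S¹E = Ω¹ ⊗_A E`, and for `n ≥ 2` the kernel
of `Ω¹Sⁿ⁻¹E → Ω¹Ω¹Sⁿ⁻²E → Ω²Sⁿ⁻²E`. -/
abbrev Sym (n : ℕ) : Type u := (symStage C E n).lo.carrier

/-- The inclusion `ι_∧ : Sⁿ⁺¹E → Ω¹ ⊗_A SⁿE`; it is the identity for `n = 0`. -/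
def symIncl (n : ℕ) : Sym C E (n + 1) →ₗ[A] FormTensor C 1 (Sym C E n) := (symStage C E n).l

variable {C E} in
/-- Compatible maps `SⁿE → JⁿE` and `Sⁿ⁺¹E → Jⁿ⁺¹E`. -/
structure IotaStage (s : SymStage C) (t : JetStage C E) where
  lo : s.lo.carrier →ₗ[A] t.lo.carrier
  hi : s.hi.carrier →ₗ[A] t.hi.carrier
  compat : ∀ x, t.l (hi x) = iota C t.lo.carrier (ftMap C 1 lo (s.l x))

/-- The maps in orders `0` and `1`. -/
noncomputable def IotaStage.zero : IotaStage (SymStage.zero C E) (JetStage.zero C E) where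
  lo := LinearMap.id
  hi := iota C E
  compat x := by
    have h : ∀ y : FormTensor C 1 E, ftMap C 1 LinearMap.id y = y := by
      intro y
      induction y using ft_induction with
      | h ω m => rfl
      | h0 => simp
      | hadd x y hx hy => rw [map_add, hx, hy]
    exact congrArg (iota C E) (h x).symm

variable {C E} in
/-- The map of order `n + 2` is obtained by restricting
`Sⁿ⁺²E → Ω¹Sⁿ⁺¹E → Ω¹Jⁿ⁺¹E → J¹Jⁿ⁺¹E`. -/
noncomputable def IotaStage.succ {s : SymStage C} {t : JetStage C E} (i : IotaStage s t) :
    IotaStage s.succ t.succ where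
  lo := i.hi
  hi := LinearMap.codRestrict (holonomic C t.l)
    ((iota C t.hi.carrier).comp ((ftMap C 1 i.hi).comp (symmetric C s.l).subtype))
    (fun x => by
      have h : jetMap C t.l (iota C t.hi.carrier (ftMap C 1 i.hi x.1)) =
          jetMap C (iota C t.lo.carrier) (iota C _ (ftMap C 1 (ftMap C 1 i.lo)
            (ftMap C 1 s.l x.1))) := by
        rw [iota_natural, iota_natural]
        congr 1
        induction x.1 using ft_induction with
        | h ω m => simp [i.compat]
        | h0 => simp
        | hadd x y hx hy => simp only [map_add, hx, hy]
      have hx : wedge11 C s.lo.carrier (ftMap C 1 s.l x.1) = 0 := x.2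
      refine ⟨?_, ?_⟩
      · change DI C _ (jetMap C t.l (iota C t.hi.carrier (ftMap C 1 i.hi x.1))) = 0
        rw [h, DI_iota_iota]
      · change DII C _ (jetMap C t.l (iota C t.hi.carrier (ftMap C 1 i.hi x.1))) = 0
        rw [h, DII_iota_iota, wedge11_natural, hx, map_zero])
  compat _ := rfl

/-- The tower of maps from symmetric forms to jets. -/
noncomputable def iotaStage : (n : ℕ) → IotaStage (symStage C E n) (jetStage C E n)
  | 0 => IotaStage.zero C E
  | n + 1 => (iotaStage n).succ

/-- The natural map `ιⁿ : SⁿE → JⁿE`. -/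
noncomputable def jetIota (n : ℕ) : Sym C E n →ₗ[A] Jet C E n := (iotaStage C E n).lo

theorem jetIncl_jetProl (n : ℕ) (e : E) :
    jetIncl C E n (jetProl C E (n + 1) e) = prol C (jetProl C E n e) :=
  (jetStage C E n).l_jhi e

theorem jetProj_jetProl (n : ℕ) (e : E) :
    jetProj C E n (jetProl C E (n + 1) e) = jetProl C E n e := by
  rw [jetProj, LinearMap.comp_apply, jetIncl_jetProl, proj_prol]

theorem jetIncl_jetIota (n : ℕ) (x : Sym C E (n + 1)) :
    jetIncl C E n (jetIota C E (n + 1) x) =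
      iota C (Jet C E n) (ftMap C 1 (jetIota C E n) (symIncl C E n x)) :=
  (iotaStage C E n).compat x

theorem jetProj_jetIota (n : ℕ) (x : Sym C E (n + 1)) :
    jetProj C E n (jetIota C E (n + 1) x) = 0 := by
  rw [jetProj, LinearMap.comp_apply, jetIncl_jetIota, proj_iota]

/-- Right exactness of the `n`-jet sequence `SⁿE → JⁿE → Jⁿ⁻¹E → 0` at `E`, where `J⁻¹E = 0`. -/
def JetRightExact : ℕ → Prop
  | 0 => Function.Surjective (jetIota C E 0)
  | n + 1 => Function.Exact (jetIota C E (n + 1)) (jetProj C E n) ∧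
      Function.Surjective (jetProj C E n)

/-- The module of elemental jets: the `A`-submodule of `JⁿE` generated by prolongations. -/
def elementalJets (n : ℕ) : Submodule A (Jet C E n) :=
  Submodule.span A (Set.range (jetProl C E n))

/-! ### Differential operators and symbols -/

section Operators

variable (n : ℕ)
variable (F : Type v) [AddCommGroup F] [Module 𝕜 F] [Module A F] [IsScalarTower 𝕜 A F]

/-- Linear differential operators `E → F` of order at most `n`: the `𝕜`-linear maps that factor as
an `A`-linear map `JⁿE → F` after the prolongation `jⁿ`. -/
def DiffOp : Submodule 𝕜 (E →ₗ[𝕜] F) where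
  carrier := {Δ | ∃ L : Jet C E n →ₗ[A] F, ∀ e, Δ e = L (jetProl C E n e)}
  add_mem' := by
    rintro Δ Δ' ⟨L, hL⟩ ⟨L', hL'⟩
    exact ⟨L + L', fun e => by simp [hL, hL']⟩
  zero_mem' := ⟨0, fun e => by simp⟩
  smul_mem' := by
    rintro c Δ ⟨L, hL⟩
    exact ⟨c • L, fun e => by simp [hL]⟩

/-- Differential operators of order at most `n - 1`, where only `0` has order at most `-1`. -/
def DiffOpLower : ℕ → Submodule 𝕜 (E →ₗ[𝕜] F)
  | 0 => ⊥
  | n + 1 => DiffOp C E n F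

theorem diffOp_le_succ : DiffOp C E n F ≤ DiffOp C E (n + 1) F := by
  rintro Δ ⟨L, hL⟩
  exact ⟨L.comp (jetProj C E n), fun e => by
    rw [LinearMap.comp_apply, jetProj_jetProl, hL]⟩

theorem diffOp_mono : Monotone (fun n => DiffOp C E n F) :=
  monotone_nat_of_le_succ fun n => diffOp_le_succ C E n F

/-- Differential operators of finite order. -/
def DiffOpFin : Submodule 𝕜 (E →ₗ[𝕜] F) where
  carrier := {Δ | ∃ n, Δ ∈ DiffOp C E n F}
  add_mem' := by
    rintro Δ Δ' ⟨n, hn⟩ ⟨m, hm⟩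
    exact ⟨max n m, add_mem (diffOp_mono C E F (le_max_left n m) hn)
      (diffOp_mono C E F (le_max_right n m) hm)⟩
  zero_mem' := ⟨0, zero_mem _⟩
  smul_mem' := by
    rintro c Δ ⟨n, hn⟩
    exact ⟨n, Submodule.smul_mem _ c hn⟩

/-- The inclusion of operators of order at most `n` into those of finite order. -/
def toFin : DiffOp C E n F →ₗ[𝕜] DiffOpFin C E F :=
  Submodule.inclusion (fun _ h => ⟨n, h⟩)

/-- The module of symbols of order `n`: operators of order at most `n` modulo operators of order
at most `n - 1`. -/
abbrev Symb : Type _ := DiffOp C E n F ⧸ (DiffOpLower C E F n).submoduleOf (DiffOp C E n F)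

/-- The symbol map `ςⁿ`. -/
def symbol : DiffOp C E n F →ₗ[𝕜] Symb C E n F :=
  ((DiffOpLower C E F n).submoduleOf (DiffOp C E n F)).mkQ

/-- The graded module of symbols `⨁ₙ Symbⁿ(E, F)`. -/
abbrev SymbAll : Type _ := ⨁ n : ℕ, Symb C E n F

variable {F}
variable {G : Type v} [AddCommGroup G] [Module 𝕜 G] [Module A G] [IsScalarTower 𝕜 A G]

theorem comp_mem_diffOp (φ : F →ₗ[A] G) {Δ : E →ₗ[𝕜] F} (h : Δ ∈ DiffOp C E n F) :
    (φ.restrictScalars 𝕜).comp Δ ∈ DiffOp C E n G := by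
  obtain ⟨L, hL⟩ := h
  exact ⟨φ.comp L, fun e => by simp [hL]⟩

theorem comp_mem_diffOpLower (φ : F →ₗ[A] G) {Δ : E →ₗ[𝕜] F} (h : Δ ∈ DiffOpLower C E F n) :
    (φ.restrictScalars 𝕜).comp Δ ∈ DiffOpLower C E G n := by
  cases n with
  | zero =>
    have h0 : Δ = 0 := h
    rw [h0, LinearMap.comp_zero]
    exact zero_mem _
  | succ n => exact comp_mem_diffOp C E n φ h

/-- The functor `Diffⁿ(E, -)` on morphisms: composition with `φ`. -/
def diffMap (φ : F →ₗ[A] G) : DiffOp C E n F →ₗ[𝕜] DiffOp C E n G :=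
  LinearMap.restrict (LinearMap.compRight 𝕜 (φ.restrictScalars 𝕜))
    (fun _ h => comp_mem_diffOp C E n φ h)

/-- The functor `Diff(E, -)` on morphisms: composition with `φ`. -/
def diffFinMap (φ : F →ₗ[A] G) : DiffOpFin C E F →ₗ[𝕜] DiffOpFin C E G :=
  LinearMap.restrict (LinearMap.compRight 𝕜 (φ.restrictScalars 𝕜))
    (fun _ ⟨n, h⟩ => ⟨n, comp_mem_diffOp C E n φ h⟩)

/-- The functor `Symbⁿ(E, -)` on morphisms, induced by composition with `φ`. -/
def symbMap (φ : F →ₗ[A] G) : Symb C E n F →ₗ[𝕜] Symb C E n G :=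
  Submodule.mapQ _ _ (diffMap C E n φ) (fun _ h => comp_mem_diffOpLower C E n φ h)

/-- The functor `⨁ₙ Symbⁿ(E, -)` on morphisms. -/
noncomputable def symbAllMap (φ : F →ₗ[A] G) : SymbAll C E F →ₗ[𝕜] SymbAll C E G :=
  DirectSum.lmap (fun n => symbMap C E n φ)

end Operators

/-! ### The restriction symbol -/

section Restriction

variable {n : ℕ}
variable {F : Type v} [AddCommGroup F] [Module 𝕜 F] [Module A F] [IsScalarTower 𝕜 A F]

variable {C E} in
/-- If symmetric forms are elemental jets, two lifts of the same operator agree on them. -/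
theorem lift_iota_unique (h : LinearMap.range (jetIota C E n) ≤ elementalJets C E n)
    (L L' : Jet C E n →ₗ[A] F) (hL : ∀ e, L (jetProl C E n e) = L' (jetProl C E n e)) :
    L.comp (jetIota C E n) = L'.comp (jetIota C E n) := by
  ext x
  have hx : jetIota C E n x ∈ LinearMap.eqLocus L L' := by
    have hle : elementalJets C E n ≤ LinearMap.eqLocus L L' := by
      refine Submodule.span_le.mpr ?_
      rintro _ ⟨e, rfl⟩
      exact hL e
    exact hle (h ⟨x, rfl⟩)
  exact hx

/-- Restriction of a lift of an operator to symmetric forms. -/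
noncomputable def restrictOp (h : LinearMap.range (jetIota C E n) ≤ elementalJets C E n) :
    DiffOp C E n F →ₗ[𝕜] (Sym C E n →ₗ[A] F) where
  toFun Δ := (Classical.choose Δ.2).comp (jetIota C E n)
  map_add' Δ Δ' := by
    rw [← LinearMap.add_comp]
    refine lift_iota_unique h _ _ fun e => ?_
    rw [LinearMap.add_apply, ← Classical.choose_spec (Δ + Δ').2 e, ← Classical.choose_spec Δ.2 e,
      ← Classical.choose_spec Δ'.2 e]
    rfl
  map_smul' c Δ := by
    rw [RingHom.id_apply, ← LinearMap.smul_comp]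
    refine lift_iota_unique h _ _ fun e => ?_
    rw [LinearMap.smul_apply, ← Classical.choose_spec (c • Δ).2 e, ← Classical.choose_spec Δ.2 e]
    rfl

theorem restrictOp_eq (h : LinearMap.range (jetIota C E n) ≤ elementalJets C E n)
    (Δ : DiffOp C E n F) (L : Jet C E n →ₗ[A] F) (hL : ∀ e, Δ.1 e = L (jetProl C E n e)) :
    restrictOp C E h Δ = L.comp (jetIota C E n) :=
  lift_iota_unique h _ _ fun e => by rw [← Classical.choose_spec Δ.2 e, hL]

/-- The restriction symbol map `r : Symbⁿ(E, F) → Hom_A(SⁿE, F)`, which sends the symbol of an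
operator `Δ` with lift `L : JⁿE → F` to `L ∘ ιⁿ`. It is defined when `ιⁿ` takes values in elemental
jets. -/
noncomputable def restrictionSymbol
    (h : LinearMap.range (jetIota C E n) ≤ elementalJets C E n) :
    Symb C E n F →ₗ[𝕜] (Sym C E n →ₗ[A] F) :=
  Submodule.liftQ _ (restrictOp C E h) (by
    rintro ⟨Δ, hΔ⟩ hlow
    have hlow' : Δ ∈ DiffOpLower C E F n := hlow
    rw [LinearMap.mem_ker]
    cases n with
    | zero =>
      have h0 : Δ = 0 := hlow'
      rw [restrictOp_eq C E h ⟨Δ, hΔ⟩ 0 (fun e => by simp [h0]), LinearMap.zero_comp]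
    | succ n =>
      obtain ⟨L, hL⟩ := hlow'
      rw [restrictOp_eq C E h ⟨Δ, hΔ⟩ (L.comp (jetProj C E n)) (fun e => by
        rw [LinearMap.comp_apply, jetProj_jetProl]; exact hL e)]
      ext x
      simp [jetProj_jetIota])

theorem restrictionSymbol_symbol (h : LinearMap.range (jetIota C E n) ≤ elementalJets C E n)
    (Δ : DiffOp C E n F) (L : Jet C E n →ₗ[A] F) (hL : ∀ e, Δ.1 e = L (jetProl C E n e)) :
    restrictionSymbol C E h (symbol C E n F Δ) = L.comp (jetIota C E n) :=
  restrictOp_eq C E h Δ L hL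

variable {C E} in
theorem range_iota_le (h : elementalJets C E n = ⊤) :
    LinearMap.range (jetIota C E n) ≤ elementalJets C E n :=
  h ▸ le_top

end Restriction

/-! ### Quantizations -/

/-- A natural `n`-quantization for `E`: a natural transformation
`Symbⁿ(E, -) → Diffⁿ(E, -)` of functors from left `A`-modules to `𝕜`-modules that is a section of
the symbol map. -/
structure NaturalQuantization (n : ℕ) where
  app : ∀ (F : Type v) [AddCommGroup F] [Module 𝕜 F] [Module A F] [IsScalarTower 𝕜 A F],
    Symb C E n F →ₗ[𝕜] DiffOp C E n F
  natural : ∀ (F G : Type v) [AddCommGroup F] [Module 𝕜 F] [Module A F] [IsScalarTower 𝕜 A F]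
    [AddCommGroup G] [Module 𝕜 G] [Module A G] [IsScalarTower 𝕜 A G]
    (φ : F →ₗ[A] G) (σ : Symb C E n F),
    app G (symbMap C E n φ σ) = diffMap C E n φ (app F σ)
  isSection : ∀ (F : Type v) [AddCommGroup F] [Module 𝕜 F] [Module A F] [IsScalarTower 𝕜 A F]
    (σ : Symb C E n F), symbol C E n F (app F σ) = σ

/-- A natural full quantization for `E`: the natural transformation
`⨁ₙ Symbⁿ(E, -) → Diff(E, -)` that is the sum of a collection of natural `n`-quantizations. -/
structure NaturalFullQuantization where
  app : ∀ (F : Type v) [AddCommGroup F] [Module 𝕜 F] [Module A F] [IsScalarTower 𝕜 A F],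
    SymbAll C E F →ₗ[𝕜] DiffOpFin C E F
  natural : ∀ (F G : Type v) [AddCommGroup F] [Module 𝕜 F] [Module A F] [IsScalarTower 𝕜 A F]
    [AddCommGroup G] [Module 𝕜 G] [Module A G] [IsScalarTower 𝕜 A G]
    (φ : F →ₗ[A] G) (σ : SymbAll C E F),
    app G (symbAllMap C E φ σ) = diffFinMap C E φ (app F σ)
  component : ∀ n : ℕ, NaturalQuantization.{u, v} C E n
  app_eq_sum : ∀ (F : Type v) [AddCommGroup F] [Module 𝕜 F] [Module A F] [IsScalarTower 𝕜 A F],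
    app F = DirectSum.toModule 𝕜 ℕ (DiffOpFin C E F)
      (fun n => (toFin C E n F).comp ((component n).app F))

/-! ### Connections and the iterated operator -/

/-- A (left) connection on the left `A`-module `M`. -/
structure Connection (M : Type u) [AddCommGroup M] [Module 𝕜 M] [Module A M]
    [IsScalarTower 𝕜 A M] where
  toMap : M →ₗ[𝕜] FormTensor C 1 M
  leibniz : ∀ (a : A) (m : M), toMap (a • m) = ft C (dA C a) m + a • toMap m

/-- A left splitting in left `A`-modules (a retraction) of `Sᵏ⁺¹E → Ω¹ ⊗_A SᵏE`. -/
structure Retraction (k : ℕ) where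
  toMap : FormTensor C 1 (Sym C E k) →ₗ[A] Sym C E (k + 1)
  leftInverse : ∀ x : Sym C E (k + 1), toMap (symIncl C E k x) = x

variable {C E} in
/-- The operator `s^{n-1} ∘ ∇^{n-1} ∘ ⋯ ∘ s¹ ∘ ∇¹ ∘ s⁰ ∘ ∇⁰ : E → SⁿE`. Here `s⁰` is the
identity of `Ω¹ ⊗_A E`, being a retraction of the identity. -/
def iteratedOp : (n : ℕ) → (∀ k < n, Connection C (Sym C E k)) → (∀ k < n, Retraction C E k) →
    (E →ₗ[𝕜] Sym C E n)
  | 0, _, _ => LinearMap.id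
  | n + 1, c, s =>
    ((s n n.lt_succ_self).toMap.restrictScalars 𝕜).comp
      ((c n n.lt_succ_self).toMap.comp
        (iteratedOp n (fun k hk => c k (hk.trans n.lt_succ_self))
          (fun k hk => s k (hk.trans n.lt_succ_self))))

end

end NCJet

/-!
A connection on `M` is the same thing as an `A`-linear splitting of `ι : Ω¹ ⊗_A M → J¹M`. Composing
`JⁿE → J¹Jⁿ⁻¹E → J¹Sⁿ⁻¹E → Ω¹Sⁿ⁻¹E → SⁿE`, where the second map is induced by a splitting of `ιⁿ⁻¹`
and the third by the connection, therefore gives by recursion a splitting `p` of `ιⁿ` such that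
`p ∘ jⁿ` is the iterated operator. For any splitting `p` of `ιⁿ`, the operators `r(σ) ∘ p ∘ jⁿ` form
a natural quantization: the restriction symbol of `r(σ) ∘ p ∘ jⁿ` is `r(σ) ∘ p ∘ ιⁿ = r(σ)`, and
right exactness of the jet sequence makes `r` injective.
-/

namespace NCJet

theorem exists_comp_eq_of_exact_of_surjective {R M₁ M₂ M₃ N : Type*} [Ring R]
    [AddCommGroup M₁] [AddCommGroup M₂] [AddCommGroup M₃] [AddCommGroup N]
    [Module R M₁] [Module R M₂] [Module R M₃] [Module R N]
    {f : M₁ →ₗ[R] M₂} {g : M₂ →ₗ[R] M₃} (hfg : Function.Exact f g) (hg : Function.Surjective g)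
    {h : M₂ →ₗ[R] N} (hf : h.comp f = 0) : ∃ k : M₃ →ₗ[R] N, k.comp g = h := by
  use ((LinearMap.range f).liftQ h (LinearMap.range_le_ker_iff.mpr hf)).comp
    (hfg.linearEquivOfSurjective hg).symm.toLinearMap
  ext x
  simp

section

variable {𝕜 : Type w} {A Ω : Type u} [CommRing 𝕜] [Ring A] [Algebra 𝕜 A] [Ring Ω] [Algebra 𝕜 Ω]
variable {C : ExteriorCalculus 𝕜 A Ω}

section OneJetSplitting

variable {M : Type u} [AddCommGroup M] [Module 𝕜 M] [Module A M] [IsScalarTower 𝕜 A M]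
variable {M' : Type u} [AddCommGroup M'] [Module 𝕜 M'] [Module A M'] [IsScalarTower 𝕜 A M']

theorem leftInverse_ftMap {k : ℕ} {f : M →ₗ[A] M'} {g : M' →ₗ[A] M}
    (h : Function.LeftInverse g f) : Function.LeftInverse (ftMap C k g) (ftMap C k f) := by
  intro x
  induction x using ft_induction with
  | h ω m => rw [ftMap_ft, ftMap_ft, h m]
  | h0 => simp only [map_zero]
  | hadd x y hx hy => simp only [map_add, hx, hy]

theorem Connection.smul_toMap_smul (c : Connection C M) (a b : A) (m : M) :
    a • c.toMap (b • m) = (a * b) • c.toMap m + ft C (a • dA C b) m := by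
  rw [c.leibniz, smul_add, mul_smul, left_smul_ft, add_comm]

/-- The `A`-linear map `[a ⊗ m] ↦ a ∇m` from `J¹M` to `Ω¹ ⊗_A M`, the splitting of the 1-jet
sequence corresponding to the connection `∇`. -/
def Connection.splitting (c : Connection C M) : OneJet C M →ₗ[A] FormTensor C 1 M :=
  jetLiftA C c.toMap fun t ht m =>
    vanish_on_jetRel C _ m
      ((LinearMap.toSpanSingleton A _ (c.toMap m)).restrictScalars 𝕜) ((ftHom C).flip m)
      (fun a b => c.smul_toMap_smul a b m) t ht

theorem Connection.splitting_prol (c : Connection C M) (m : M) :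
    c.splitting (prol C m) = c.toMap m :=
  jetLiftA_prol C _ _ m

theorem Connection.leftInverse_splitting (c : Connection C M) :
    Function.LeftInverse c.splitting (iota C M) := by
  intro x
  induction x using ft_one_induction with
  | h a b m =>
    rw [iota_adb, map_sub, map_smul c.splitting, map_smul c.splitting, c.splitting_prol,
      c.splitting_prol, c.smul_toMap_smul, add_sub_cancel_left]
  | h0 => simp only [map_zero]
  | hadd x y hx hy => simp only [map_add, hx, hy]

end OneJetSplitting

variable {E : Type u} [AddCommGroup E] [Module 𝕜 E] [Module A E] [IsScalarTower 𝕜 A E]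

/-- The splitting `JⁿE → SⁿE` of `ιⁿ` built from connections on the `SᵏE` and retractions of the
inclusions `Sᵏ⁺¹E → Ω¹ ⊗_A SᵏE`, for `k < n`. -/
def jetSplitting : (n : ℕ) → (∀ k < n, Connection C (Sym C E k)) → (∀ k < n, Retraction C E k) →
    (Jet C E n →ₗ[A] Sym C E n)
  | 0, _, _ => LinearMap.id
  | n + 1, c, s =>
    (s n n.lt_succ_self).toMap.comp ((c n n.lt_succ_self).splitting.comp
      ((jetMap C (jetSplitting n (fun k hk => c k (hk.trans n.lt_succ_self))
        (fun k hk => s k (hk.trans n.lt_succ_self)))).comp (jetIncl C E n)))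

theorem jetSplitting_jetProl (n : ℕ) (c : ∀ k < n, Connection C (Sym C E k))
    (s : ∀ k < n, Retraction C E k) (e : E) :
    jetSplitting n c s (jetProl C E n e) = iteratedOp n c s e := by
  induction n with
  | zero => rfl
  | succ n ih =>
    simp only [jetSplitting, iteratedOp, LinearMap.comp_apply, LinearMap.restrictScalars_apply,
      jetIncl_jetProl, jetMap_prol, ih, Connection.splitting_prol]

theorem leftInverse_jetSplitting (n : ℕ) (c : ∀ k < n, Connection C (Sym C E k))
    (s : ∀ k < n, Retraction C E k) :
    Function.LeftInverse (jetSplitting n c s) (jetIota C E n) := by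
  induction n with
  | zero => exact fun _ => rfl
  | succ n ih =>
    intro x
    simp only [jetSplitting, LinearMap.comp_apply]
    rw [jetIncl_jetIota, iota_natural, Connection.leftInverse_splitting, leftInverse_ftMap (ih _ _),
      Retraction.leftInverse]

section Symbols

variable {n : ℕ}
variable {F : Type v} [AddCommGroup F] [Module 𝕜 F] [Module A F] [IsScalarTower 𝕜 A F]
variable {G : Type v} [AddCommGroup G] [Module 𝕜 G] [Module A G] [IsScalarTower 𝕜 A G]

/-- The differential operator `L ∘ jⁿ` with lift `L : JⁿE → F`. -/
def operatorOfLift (L : Jet C E n →ₗ[A] F) : DiffOp C E n F :=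
  ⟨(L.restrictScalars 𝕜).comp (jetProl C E n), L, fun _ => rfl⟩

theorem exists_symbol_operatorOfLift_eq (σ : Symb C E n F) :
    ∃ L : Jet C E n →ₗ[A] F, symbol C E n F (operatorOfLift L) = σ := by
  obtain ⟨Δ, rfl⟩ := Submodule.mkQ_surjective _ σ
  obtain ⟨L, hL⟩ := Δ.2
  exact ⟨L, congrArg _ (Subtype.ext (LinearMap.ext fun e => (hL e).symm))⟩

theorem operatorOfLift_mem_diffOpLower (hE : JetRightExact C E n) {L : Jet C E n →ₗ[A] F}
    (hL : L.comp (jetIota C E n) = 0) :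
    (operatorOfLift L : E →ₗ[𝕜] F) ∈ DiffOpLower C E F n := by
  cases n with
  | zero =>
    have hL0 : L = 0 := (LinearMap.cancel_right hE).mp (by rw [hL, LinearMap.zero_comp])
    rw [hL0]
    exact zero_mem _
  | succ n =>
    obtain ⟨K, rfl⟩ := exists_comp_eq_of_exact_of_surjective hE.1 hE.2 hL
    exact ⟨K, fun e => congrArg K (jetProj_jetProl C E n e)⟩

variable (hι : LinearMap.range (jetIota C E n) ≤ elementalJets C E n)

theorem restrictionSymbol_symbol_operatorOfLift (L : Jet C E n →ₗ[A] F) :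
    restrictionSymbol C E hι (symbol C E n F (operatorOfLift L)) = L.comp (jetIota C E n) :=
  restrictionSymbol_symbol C E hι _ L fun _ => rfl

theorem restrictionSymbol_symbMap (φ : F →ₗ[A] G) (σ : Symb C E n F) :
    restrictionSymbol C E hι (symbMap C E n φ σ) = φ.comp (restrictionSymbol C E hι σ) := by
  obtain ⟨L, rfl⟩ := exists_symbol_operatorOfLift_eq σ
  have hφL : symbMap C E n φ (symbol C E n F (operatorOfLift L)) =
      symbol C E n G (operatorOfLift (φ.comp L)) := rfl
  rw [hφL, restrictionSymbol_symbol_operatorOfLift, restrictionSymbol_symbol_operatorOfLift,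
    LinearMap.comp_assoc]

theorem restrictionSymbol_injective (hE : JetRightExact C E n) :
    Function.Injective (restrictionSymbol C E hι (F := F)) := by
  refine (injective_iff_map_eq_zero _).mpr fun σ hσ => ?_
  obtain ⟨L, rfl⟩ := exists_symbol_operatorOfLift_eq σ
  rw [restrictionSymbol_symbol_operatorOfLift] at hσ
  exact (Submodule.Quotient.mk_eq_zero _).mpr (operatorOfLift_mem_diffOpLower hE hσ)

/-- The map `σ ↦ r(σ) ∘ p ∘ jⁿ` from symbols to operators given by `p : JⁿE → SⁿE`. -/
noncomputable def quantize (p : Jet C E n →ₗ[A] Sym C E n) :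
    Symb C E n F →ₗ[𝕜] DiffOp C E n F where
  toFun σ := operatorOfLift ((restrictionSymbol C E hι σ).comp p)
  map_add' σ τ := by rw [map_add]; rfl
  map_smul' a σ := by rw [map_smul]; rfl

theorem quantize_symbMap (p : Jet C E n →ₗ[A] Sym C E n) (φ : F →ₗ[A] G) (σ : Symb C E n F) :
    quantize hι p (symbMap C E n φ σ) = diffMap C E n φ (quantize hι p σ) := by
  ext e
  exact LinearMap.congr_fun (restrictionSymbol_symbMap hι φ σ) (p (jetProl C E n e))

theorem symbol_quantize (hE : JetRightExact C E n) {p : Jet C E n →ₗ[A] Sym C E n}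
    (hp : Function.LeftInverse p (jetIota C E n)) (σ : Symb C E n F) :
    symbol C E n F (quantize hι p σ) = σ := by
  apply restrictionSymbol_injective hι hE
  calc restrictionSymbol C E hι (symbol C E n F (quantize hι p σ))
    _ = ((restrictionSymbol C E hι σ).comp p).comp (jetIota C E n) :=
      restrictionSymbol_symbol_operatorOfLift hι _
    _ = restrictionSymbol C E hι σ :=
      LinearMap.ext fun x => congrArg (restrictionSymbol C E hι σ) (hp x)

/-- The natural `n`-quantization `σ ↦ r(σ) ∘ p ∘ jⁿ` given by a splitting `p` of `ιⁿ`. -/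
noncomputable def NaturalQuantization.ofSplitting (hE : JetRightExact C E n)
    (p : Jet C E n →ₗ[A] Sym C E n) (hp : Function.LeftInverse p (jetIota C E n)) :
    NaturalQuantization.{u, v} C E n where
  app _ _ _ _ _ := quantize hι p
  natural _ _ _ _ _ _ _ _ _ _ φ σ := quantize_symbMap hι p φ σ
  isSection _ _ _ _ _ σ := symbol_quantize hι hE hp σ

end Symbols

/-- The natural full quantization `∑ₙ qⁿ` with components `qⁿ`. -/
noncomputable def NaturalFullQuantization.ofComponents
    (q : ∀ n, NaturalQuantization.{u, v} C E n) : NaturalFullQuantization.{u, v} C E where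
  app F _ _ _ _ := DirectSum.toModule 𝕜 ℕ (DiffOpFin C E F)
    fun n => (toFin C E n F).comp ((q n).app F)
  natural F G _ _ _ _ _ _ _ _ φ σ := by
    induction σ using DirectSum.induction_on with
    | zero => simp only [map_zero]
    | of n τ =>
      simp only [← DirectSum.lof_eq_of 𝕜, symbAllMap, DirectSum.lmap_lof, DirectSum.toModule_lof,
        LinearMap.comp_apply, (q n).natural]
      rfl
    | add σ τ hσ hτ => simp only [map_add, hσ, hτ]
  component := q
  app_eq_sum _ _ _ _ _ := rfl

end

end NCJet

open NCJet in
theorem corollary5p11_general {𝕜 : Type w} {A Ω : Type u} [CommRing 𝕜] [Ring A] [Algebra 𝕜 A]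
    [Ring Ω] [Algebra 𝕜 Ω] (C : ExteriorCalculus 𝕜 A Ω)
    (E : Type u) [AddCommGroup E] [Module 𝕜 E] [Module A E] [IsScalarTower 𝕜 A E] :
    (∀ (n : ℕ) (hι : LinearMap.range (jetIota C E n) ≤ elementalJets C E n)
        (_ : JetRightExact C E n) (p : Jet C E n →ₗ[A] Sym C E n)
        (_ : Function.LeftInverse p (jetIota C E n)),
      ∃ q : NaturalQuantization.{u, v} C E n,
        ∀ (F : Type v) [AddCommGroup F] [Module 𝕜 F] [Module A F] [IsScalarTower 𝕜 A F]
          (σ : Symb C E n F) (e : E),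
          (q.app F σ : E →ₗ[𝕜] F) e = restrictionSymbol C E hι σ (p (jetProl C E n e))) ∧
    (∀ (hι : ∀ n, LinearMap.range (jetIota C E n) ≤ elementalJets C E n)
        (_ : ∀ n, JetRightExact C E n) (p : ∀ n, Jet C E n →ₗ[A] Sym C E n)
        (_ : ∀ n, Function.LeftInverse (p n) (jetIota C E n)),
      ∃ q : NaturalFullQuantization.{u, v} C E,
        ∀ (n : ℕ) (F : Type v) [AddCommGroup F] [Module 𝕜 F] [Module A F] [IsScalarTower 𝕜 A F]
          (σ : Symb C E n F) (e : E),
          ((q.component n).app F σ : E →ₗ[𝕜] F) e =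
            restrictionSymbol C E (hι n) σ (p n (jetProl C E n e))) :=
  ⟨fun _ hι hE p hp => ⟨.ofSplitting hι hE p hp, fun _ _ _ _ _ _ _ => rfl⟩,
    fun hι hE p hp => ⟨.ofComponents fun n => .ofSplitting (hι n) (hE n) (p n) (hp n),
      fun _ _ _ _ _ _ _ _ => rfl⟩⟩

open NCJet in
theorem corollary5p11 {𝕜 : Type w} {A Ω : Type u} [CommRing 𝕜] [Ring A] [Algebra 𝕜 A]
    [Ring Ω] [Algebra 𝕜 Ω] (C : ExteriorCalculus 𝕜 A Ω)
    (E : Type u) [AddCommGroup E] [Module 𝕜 E] [Module A E] [IsScalarTower 𝕜 A E] :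
    (∀ (n : ℕ) (hJ : elementalJets C E n = ⊤) (_ : JetRightExact C E n)
        (c : ∀ k < n, Connection C (Sym C E k)) (s : ∀ k < n, Retraction C E k),
      ∃ q : NaturalQuantization.{u, v} C E n,
        ∀ (F : Type v) [AddCommGroup F] [Module 𝕜 F] [Module A F] [IsScalarTower 𝕜 A F]
          (σ : Symb C E n F) (e : E),
          (q.app F σ : E →ₗ[𝕜] F) e =
            restrictionSymbol C E (range_iota_le hJ) σ (iteratedOp n c s e)) ∧
    (∀ (hJ : ∀ n, elementalJets C E n = ⊤) (_ : ∀ n, JetRightExact C E n)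
        (c : ∀ k, Connection C (Sym C E k)) (s : ∀ k, Retraction C E k),
      ∃ q : NaturalFullQuantization.{u, v} C E,
        ∀ (n : ℕ) (F : Type v) [AddCommGroup F] [Module 𝕜 F] [Module A F] [IsScalarTower 𝕜 A F]
          (σ : Symb C E n F) (e : E),
          ((q.component n).app F σ : E →ₗ[𝕜] F) e =
            restrictionSymbol C E (range_iota_le (hJ n)) σ
              (iteratedOp n (fun k _ => c k) (fun k _ => s k) e)) := by
  simp only [← jetSplitting_jetProl]
  exact ⟨fun n hJ hE c s => (corollary5p11_general C E).1 n (range_iota_le hJ) hE _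
      (leftInverse_jetSplitting n c s),
    fun hJ hE c s => (corollary5p11_general C E).2 (fun n => range_iota_le (hJ n)) hE _
      fun n => leftInverse_jetSplitting n _ _⟩
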